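/- Let $k$ be a perfect field and let $\Gamma$ be a $k$-algebra (with $k$ acting centrally) which is a bounded principal ideal domain, that is, a not necessarily commutative domain in which all left ideals and all right ideals are principal and every nonzero one-sided ideal contains a nonzero two-sided ideal. For a left $\Gamma$-module $M$ let $\operatorname{Endol}(M)$ be its endolength, i.e. the length of $M$ as a right $\operatorname{End}_\Gamma(M)^{op}$-module (where $m\cdot f=f(m)$). Let $M_n$ be the indecomposable $\Gamma$-module of finite length $n\ge 1$ with socle $M_1$. Then $$\operatorname{Endol}(M_n)=n\cdot\operatorname{Endol}(M_1).$$ Here the socle of any indecomposable $\Gamma$-module of finite length is simple, an indecomposable $\Gamma$-module of finite length is determined up to isomorphism by its length and its socle, and, if $\Gamma$ is not a division ring, $M_n$ exists for every simple $\Gamma$-module $M_1$ and every $n\ge 1$. Moreover, if $\Gamma$ is not $e$-discrete, then $\Gamma$ satisfies EBTII. Here $\Gamma$ is called $e$-discrete if for each $d\in\mathbb N$ there are only finitely many isomorphism classes of indecomposable $\Gamma$-modules of finite $k$-dimension and of endolength $d$; and $\Gamma$ satisfies EBTII if there is an infinite sequence of natural numbers $d_1<d_2<\cdots$ such that for each $d_i$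 there are infinitely many pairwise non-isomorphic indecomposable $\Gamma$-modules of finite $k$-dimension and of endolength $d_i$. -/

import Mathlib

universe u v

/-- A (not necessarily commutative) bounded principal ideal domain: a domain in which every left
ideal and every right ideal is principal, and every nonzero one-sided ideal contains a nonzero
two-sided ideal. Right ideals are `Γᵐᵒᵖ`-submodules of `Γ`. Division rings are allowed. -/
structure IsBoundedPID (Γ : Type u) [Ring Γ] : Prop where
  isDomain : IsDomain Γ
  left_principal : ∀ I : Ideal Γ, ∃ a : Γ, I = Ideal.span {a}
  right_principal : ∀ I : Submodule Γᵐᵒᵖ Γ, ∃ a : Γ, I = Submodule.span Γᵐᵒᵖ {a}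
  left_bounded : ∀ I : Ideal Γ, I ≠ ⊥ → ∃ J : TwoSidedIdeal Γ, J ≠ ⊥ ∧ ∀ x ∈ J, x ∈ I
  right_bounded : ∀ I : Submodule Γᵐᵒᵖ Γ, I ≠ ⊥ →
    ∃ J : TwoSidedIdeal Γ, J ≠ ⊥ ∧ ∀ x ∈ J, x ∈ I

/-- A module is indecomposable if it is nonzero and is not the direct sum of two nonzero
submodules. -/
def IsIndecomposableModule (R : Type u) (M : Type v) [Ring R] [AddCommGroup M] [Module R M] :
    Prop :=
  Nontrivial M ∧ ∀ N P : Submodule R M, IsCompl N P → N = ⊥ ∨ P = ⊥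

/-- The socle of a module: the sum of all its simple submodules. -/
def moduleSocle (R : Type u) (M : Type v) [Ring R] [AddCommGroup M] [Module R M] :
    Submodule R M :=
  sSup {N : Submodule R M | IsSimpleModule R N}

/-- The endolength of `M`: its length as a right module over `(End M)ᵒᵖ`, acting by `m · f = f m`;
this is its length as a left module over `End M` with the evaluation action. -/
noncomputable def endolength (R : Type u) (M : Type v) [Ring R] [AddCommGroup M] [Module R M] :
    ℕ∞ :=
  Module.length (Module.End R M) M

/-- The set of isomorphism classes of indecomposable `A`-modules which are finite-dimensional
over `k` and have endolength `d`. -/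
def indecIsoclasses (k : Type v) (A : Type u) [Field k] [Ring A] [Algebra k A] (d : ℕ) :
    Set (Quotient (CategoryTheory.isIsomorphicSetoid (ModuleCat.{u} A))) :=
  {c | ∃ M : ModuleCat.{u} A, Module.Finite k (RestrictScalars k A M) ∧
    IsIndecomposableModule A M ∧ endolength A M = (d : ℕ∞) ∧ Quotient.mk _ M = c}

/-- `A` is `e`-discrete: for each endolength `d` there are only finitely many isomorphism classes
of indecomposable finite-dimensional `A`-modules of endolength `d`. -/
def IsEDiscrete (k : Type v) (A : Type u) [Field k] [Ring A] [Algebra k A] : Prop :=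
  ∀ d : ℕ, (indecIsoclasses k A d).Finite

/-- `A` satisfies EBTII: there is a sequence `d 0 < d 1 < ⋯` of natural numbers such that for each
`i` there are infinitely many pairwise non-isomorphic finite-dimensional indecomposable
`A`-modules of endolength `d i`. -/
def SatisfiesEBTII (k : Type v) (A : Type u) [Field k] [Ring A] [Algebra k A] : Prop :=
  ∃ d : ℕ → ℕ, StrictMono d ∧ ∀ i, (indecIsoclasses k A (d i)).Infinite

/-!
Suppose that `Γ` is not a division ring. Every simple module `S` is then killed by a nonzero normal
element `p` for which `Γ / Γ p` is a sum of copies of `S`. On the injective hull `X` of `S` the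
multiplication by `p` is surjective with kernel `S`, which makes `X` uniserial: its submodules of
finite length are the kernels `X n` of the powers `p ^ n`, and `X n` has length `n` and socle `S`.

These are all the indecomposable modules `M` of finite length containing `S`: by Fitting's lemma
such an `M` is killed by some least power `p ^ n`, and injectivity of `X` gives a surjection of `M`
onto `X n`. A minimal submodule `H` of `M` which still surjects onto `X n` has only the submodules
`p ^ i H`, so it meets the kernel of the surjection trivially; the surjection splits and is an
isomorphism.

The multiplication by `p` commutes with `End (X n)`, so it identifies the successive quotients of
the chain of the `X i` with `S` as `End (X n)`-modules. By injectivity of `X` every endomorphism of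
`S` extends to `X n`, so each of these `n` quotients contributes the endolength of `S`. In
particular, replacing `M` by the module of length `m` with the same socle turns infinitely many
modules of length `n` and endolength `n * e` into infinitely many of endolength `m * e`.
-/

section Length

variable {R : Type*} [Ring R] {M : Type*} [AddCommGroup M] [Module R M]

theorem length_eq_of_semilinear_bijective {R' M' : Type*} [Ring R'] [AddCommGroup M']
    [Module R' M'] {σ : R →+* R'} [RingHomSurjective σ] (f : M →ₛₗ[σ] M')
    (hf : Function.Bijective f) : Module.length R M = Module.length R' M' := by
  apply WithBot.coe_injective
  rw [Module.coe_length, Module.coe_length]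
  exact Order.krullDim_eq_of_orderIso (Submodule.orderIsoMapComapOfBijective f hf)

theorem length_ker_pow_succ {f : Module.End R M} {i : ℕ}
    (hf : LinearMap.ker f ≤ LinearMap.range (f ^ i)) :
    Module.length R (LinearMap.ker (f ^ (i + 1))) =
      Module.length R (LinearMap.ker (f ^ i)) + Module.length R (LinearMap.ker f) := by
  have hle : LinearMap.ker (f ^ i) ≤ LinearMap.ker (f ^ (i + 1)) :=
    LinearMap.ker_le_ker_comp (f ^ i) f |>.trans_eq (by rw [pow_succ']; rfl)
  have hmap : ∀ x ∈ LinearMap.ker (f ^ (i + 1)), (f ^ i) x ∈ LinearMap.ker f := fun x hx => by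
    rwa [LinearMap.mem_ker, ← Module.End.mul_apply, ← pow_succ']
  refine Module.length_eq_add_of_exact (Submodule.inclusion hle) ((f ^ i).restrict hmap)
    (Submodule.inclusion_injective hle) ?_ (LinearMap.exact_iff.2 ?_)
  · rintro ⟨x, hx⟩
    obtain ⟨y, rfl⟩ := hf hx
    exact ⟨⟨y, by rwa [LinearMap.mem_ker, pow_succ', Module.End.mul_apply]⟩, rfl⟩
  · ext x
    simp [Submodule.range_inclusion, LinearMap.restrict_apply]

theorem length_eq_mul_length_ker {f : Module.End R M} {n : ℕ} (hn : f ^ n = 0)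
    (hf : ∀ i < n, LinearMap.ker f ≤ LinearMap.range (f ^ i)) :
    Module.length R M = n * Module.length R (LinearMap.ker f) := by
  have length_ker_pow : ∀ i ≤ n, Module.length R (LinearMap.ker (f ^ i)) =
      i * Module.length R (LinearMap.ker f) := by
    intro i
    induction i with
    | zero =>
      rw [pow_zero, Module.End.one_eq_id, LinearMap.ker_id]
      simp
    | succ i ih =>
      intro hi
      rw [length_ker_pow_succ (hf i hi), ih (Nat.le_of_lt hi), Nat.cast_succ, add_one_mul]
  rw [← length_ker_pow n le_rfl, hn, LinearMap.ker_zero, Module.length_top]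

theorem isNoetherian_and_isArtinian_of_length_eq {n : ℕ} (h : Module.length R M = n) :
    IsNoetherian R M ∧ IsArtinian R M := by
  rw [← isFiniteLength_iff_isNoetherian_isArtinian, ← Module.length_ne_top_iff, h]
  exact ENat.natCast_ne_top n

theorem exists_length_eq_natCast [IsNoetherian R M] [IsArtinian R M] :
    ∃ n : ℕ, Module.length R M = n :=
  ⟨_, (ENat.natCast_toNat (Module.length_ne_top_iff.2
    (isFiniteLength_iff_isNoetherian_isArtinian.2 ⟨‹_›, ‹_›⟩))).symm⟩

end Length

section Transport

variable {R : Type u} [Ring R] {M : Type v} [AddCommGroup M] [Module R M]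
  {N : Type*} [AddCommGroup N] [Module R N]

theorem endolength_congr (e : M ≃ₗ[R] N) : endolength R M = endolength R N :=
  let σ : Module.End R M ≃+* Module.End R N := e.conjRingEquiv
  let f : M →ₛₗ[(σ : Module.End R M →+* Module.End R N)] N :=
    { toFun := e
      map_add' := map_add e
      map_smul' := fun φ m => by simp [σ] }
  length_eq_of_semilinear_bijective f e.bijective

theorem length_eq_endolength {A : Submodule R M} {K : Submodule (Module.End R M) M}
    (hKA : ∀ x, x ∈ K ↔ x ∈ A)
    (hA : ∀ f : Module.End R A, ∃ g : Module.End R M, ∀ x : A, g x = f x) :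
    Module.length (Module.End R M) K = endolength R A := by
  have mapsTo (φ : Module.End R M) : ∀ x ∈ A, φ x ∈ A := fun x hx =>
    (hKA _).1 (K.smul_mem φ ((hKA x).2 hx))
  let res : Module.End R M →+* Module.End R A :=
    { toFun := fun φ => φ.restrict (mapsTo φ)
      map_one' := rfl
      map_mul' := fun _ _ => rfl
      map_zero' := rfl
      map_add' := fun _ _ => rfl }
  have : RingHomSurjective res := ⟨fun f => (hA f).imp fun g hg =>
    LinearMap.ext fun x => Subtype.ext (hg x)⟩
  let e : K ≃ A := Equiv.subtypeEquivRight hKA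
  let e' : K →ₛₗ[res] A :=
    { toFun := e
      map_add' := fun _ _ => rfl
      map_smul' := fun _ _ => rfl }
  exact length_eq_of_semilinear_bijective e' e.bijective

theorem map_moduleSocle_le (e : M ≃ₗ[R] N) :
    (moduleSocle R M).map (e : M →ₗ[R] N) ≤ moduleSocle R N := by
  rw [Submodule.map_le_iff_le_comap]
  refine sSup_le fun A hA => Submodule.map_le_iff_le_comap.1 (le_sSup ?_)
  have : IsSimpleModule R A := hA
  exact IsSimpleModule.congr (e.submoduleMap A).symm

theorem map_moduleSocle (e : M ≃ₗ[R] N) :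
    (moduleSocle R M).map (e : M →ₗ[R] N) = moduleSocle R N :=
  (map_moduleSocle_le e).antisymm fun x hx =>
    ⟨e.symm x, map_moduleSocle_le e.symm ⟨x, hx, rfl⟩, e.apply_symm_apply x⟩

theorem nonempty_moduleSocle_equiv (e : M ≃ₗ[R] N) :
    Nonempty (moduleSocle R M ≃ₗ[R] moduleSocle R N) :=
  ⟨(e.submoduleMap _).trans (LinearEquiv.ofEq _ _ (map_moduleSocle e))⟩

end Transport

section Monolith

variable {R : Type u} [Ring R] {M : Type v} [AddCommGroup M] [Module R M] {S : Submodule R M}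

/-- `S` is the *monolith* of the module `M`: the least nonzero submodule, that is, a simple
submodule which is essential in `M`. -/
def IsMonolith (S : Submodule R M) : Prop :=
  IsLeast {T : Submodule R M | T ≠ ⊥} S

namespace IsMonolith

theorem le (hS : IsMonolith S) {T : Submodule R M} (hT : T ≠ ⊥) : S ≤ T :=
  hS.2 hT

theorem isAtom (hS : IsMonolith S) : IsAtom S :=
  ⟨hS.1, fun _ hT => not_not.1 fun hT' => hT.not_ge (hS.le hT')⟩

theorem isSimpleModule (hS : IsMonolith S) : IsSimpleModule R S :=
  isSimpleModule_iff_isAtom.2 hS.isAtom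

theorem moduleSocle_eq (hS : IsMonolith S) : moduleSocle R M = S := by
  refine le_antisymm (sSup_le fun T hT => ?_) (le_sSup hS.isSimpleModule)
  have hT : IsAtom T := isSimpleModule_iff_isAtom.1 hT
  exact ((hT.le_iff.1 (hS.le hT.1)).resolve_left hS.1).ge

theorem isIndecomposableModule (hS : IsMonolith S) : IsIndecomposableModule R M := by
  refine ⟨?_, fun A B hAB => ?_⟩
  · have := hS.isSimpleModule.nontrivial
    exact S.subtype_injective.nontrivial
  · by_contra! h
    exact hS.1 (le_bot_iff.1 (hAB.disjoint (hS.le h.1) (hS.le h.2)))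

theorem submoduleOf (hS : IsMonolith S) {N : Submodule R M} (hSN : S ≤ N) :
    IsMonolith (S.submoduleOf N) := by
  refine ⟨fun h => hS.1 ?_, fun T hT => ?_⟩
  · exact (Submodule.disjoint_iff_comap_eq_bot.2 h).symm.eq_bot_of_le hSN
  · have hle : S ≤ T.map N.subtype :=
      hS.le (by rwa [Ne, ← LinearMap.le_ker_iff_map, N.ker_subtype, le_bot_iff])
    exact (Submodule.comap_mono hle).trans_eq
      (Submodule.comap_map_eq_of_injective N.subtype_injective T)

theorem le_of_isSemisimpleModule (hS : IsMonolith S) (N : Submodule R M) [IsSemisimpleModule R N] :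
    N ≤ S := by
  by_cases hN : N = ⊥
  · exact hN.trans_le bot_le
  have hSN : IsMonolith (S.submoduleOf N) := hS.submoduleOf (hS.le hN)
  obtain ⟨Q, hQ⟩ := exists_isCompl (S.submoduleOf N)
  have hQ0 : Q = ⊥ := by
    by_contra hQ0
    exact hSN.1 (hQ.disjoint.eq_bot_of_le (hSN.le hQ0))
  exact Submodule.comap_subtype_eq_top.1 (eq_top_of_isCompl_bot (hQ0 ▸ hQ))

end IsMonolith

theorem exists_disjoint_isMonolith_map_mkQ (S : Submodule R M) [IsSimpleModule R S] :
    ∃ C : Submodule R M, Disjoint C S ∧ IsMonolith (S.map C.mkQ) := by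
  have hS : IsAtom S := isSimpleModule_iff_isAtom.1 ‹_›
  obtain ⟨C, -, hC⟩ := zorn_le_nonempty₀ {C : Submodule R M | Disjoint C S}
    (fun c hc hchain _ _ => ⟨sSup c, hchain.directedOn.disjoint_sSup_left.2 fun _ hb => hc hb,
      fun _ => le_sSup⟩) ⊥ disjoint_bot_left
  refine ⟨C, hC.1, fun h => hS.1 ?_, fun T hT => ?_⟩
  · rw [← LinearMap.le_ker_iff_map, C.ker_mkQ] at h
    exact hC.1.symm.eq_bot_of_le h
  · rw [Submodule.map_le_iff_le_comap, ← hS.not_disjoint_iff_le, disjoint_comm]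
    intro hd
    apply hT
    rw [← Submodule.map_comap_eq_of_surjective C.mkQ_surjective T,
      ← LinearMap.le_ker_iff_map, C.ker_mkQ]
    exact hC.2 hd (C.ker_mkQ.ge.trans (LinearMap.ker_le_comap _))

end Monolith

section SupIrred

variable {R : Type*} [Ring R] {M N : Type*} [AddCommGroup M] [Module R M]
  [AddCommGroup N] [Module R N]

theorem supIrred_top_submodule {W : Submodule R M} (hW : SupIrred W) :
    SupIrred (⊤ : Submodule R W) := by
  refine ⟨fun h => hW.ne_bot ?_, fun A B hAB => ?_⟩
  · rw [← W.map_subtype_top, isMin_iff_eq_bot.1 h, Submodule.map_bot]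
  · have hsup : A.map W.subtype ⊔ B.map W.subtype = W := by
      rw [← Submodule.map_sup, hAB, W.map_subtype_top]
    refine (hW.2 hsup).imp (fun h => ?_) fun h => ?_
    all_goals
      exact Submodule.map_injective_of_injective W.subtype_injective
        (h.trans W.map_subtype_top.symm)

theorem exists_supIrred_map_eq [IsArtinian R M] (f : M →ₗ[R] N) {L : Submodule R N}
    (hL : SupIrred L) (hLf : L ≤ LinearMap.range f) :
    ∃ W : Submodule R M, SupIrred W ∧ W.map f = L := by
  obtain ⟨W, hW, hmin⟩ := IsArtinian.set_has_minimal {W : Submodule R M | W.map f = L}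
    ⟨L.comap f, Submodule.map_comap_eq_self hLf⟩
  refine ⟨W, ⟨fun h => hL.ne_bot ?_, fun A B hAB => ?_⟩, hW⟩
  · rw [← hW, isMin_iff_eq_bot.1 h, Submodule.map_bot]
  · have hle : A ≤ W ∧ B ≤ W := sup_le_iff.1 hAB.le
    have hsup : A.map f ⊔ B.map f = L := by rw [← Submodule.map_sup, hAB, hW]
    exact (hL.2 hsup).imp (fun h => hle.1.eq_of_not_lt (hmin A h))
      fun h => hle.2.eq_of_not_lt (hmin B h)

end SupIrred

section NormalElement

variable {Γ : Type*} [Ring Γ] {p : Γ}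

/-- An element `p` of a ring is *normal* if `p x = σ(x) p` for some ring automorphism `σ`; in a
domain, a nonzero `p` is normal if and only if `p Γ = Γ p`. -/
def IsNormalElement (p : Γ) : Prop :=
  ∃ σ : Γ ≃+* Γ, ∀ x, SemiconjBy p x (σ x)

namespace IsNormalElement

theorem of_exists_mul_eq [IsDomain Γ] (hp : p ≠ 0) (hl : ∀ x, ∃ y, y * p = p * x)
    (hr : ∀ x, ∃ y, p * y = x * p) : IsNormalElement p := by
  choose f hf using hl
  let σ : Γ →+* Γ :=
    { toFun := f
      map_one' := mul_right_cancel₀ hp (by rw [hf, mul_one, one_mul])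
      map_mul' := fun x y => mul_right_cancel₀ hp (by
        rw [hf, ← mul_assoc, ← hf x, mul_assoc, ← hf y, mul_assoc])
      map_zero' := mul_right_cancel₀ hp (by rw [hf, mul_zero, zero_mul])
      map_add' := fun x y => mul_right_cancel₀ hp (by rw [hf, mul_add, add_mul, hf, hf]) }
  have hσ : Function.Bijective σ := by
    refine ⟨fun x y hxy => mul_left_cancel₀ hp ?_, fun x => ?_⟩
    · rw [← hf x, ← hf y]
      exact congrArg (· * p) hxy
    · obtain ⟨y, hy⟩ := hr x
      exact ⟨y, mul_right_cancel₀ hp ((hf y).trans hy)⟩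
  exact ⟨RingEquiv.ofBijective σ hσ, fun x => (hf x).symm⟩

theorem pow (hp : IsNormalElement p) (n : ℕ) : IsNormalElement (p ^ n) := by
  obtain ⟨σ, hσ⟩ := hp
  refine ⟨σ ^ n, fun x => ?_⟩
  induction n with
  | zero => simp
  | succ n ih =>
    rw [pow_succ' p, pow_succ' σ]
    exact (hσ _).mul_left ih

/-- The automorphism `σ` with `p x = σ(x) p`. -/
noncomputable def twist (hp : IsNormalElement p) : Γ ≃+* Γ :=
  hp.choose

theorem mul_eq_twist_mul (hp : IsNormalElement p) (x : Γ) : p * x = hp.twist x * p :=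
  hp.choose_spec x

variable {M : Type*} [AddCommGroup M] [Module Γ M]

/-- The multiplication by a normal element `p`, a map which is semilinear with respect to
`hp.twist`. Its kernel and its image, and the images of submodules under it, are thus submodules. -/
noncomputable def smulHom (hp : IsNormalElement p) (M : Type*) [AddCommGroup M] [Module Γ M] :
    M →ₛₗ[(hp.twist : Γ →+* Γ)] M where
  toFun x := p • x
  map_add' := smul_add p
  map_smul' c x := by
    rw [← mul_smul, hp.mul_eq_twist_mul, mul_smul]
    rfl

@[simp]
theorem smulHom_apply (hp : IsNormalElement p) (x : M) : hp.smulHom M x = p • x :=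
  rfl

theorem ker_smulHom_pow_mono (hp : IsNormalElement p) :
    Monotone fun n => LinearMap.ker ((hp.pow n).smulHom M) := by
  refine monotone_nat_of_le_succ fun n x hx => ?_
  rw [LinearMap.mem_ker, smulHom_apply] at hx ⊢
  rw [pow_succ', mul_smul, hx, smul_zero]

theorem range_smulHom_pow_anti (hp : IsNormalElement p) :
    Antitone fun n => LinearMap.range ((hp.pow n).smulHom M) := by
  refine antitone_nat_of_succ_le fun n => ?_
  rintro _ ⟨x, rfl⟩
  exact ⟨p • x, by rw [smulHom_apply, smulHom_apply, pow_succ, mul_smul]⟩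

/-- **Fitting's lemma** for the multiplication by a normal element. -/
theorem exists_isCompl_ker_range (hp : IsNormalElement p) (M : Type*) [AddCommGroup M]
    [Module Γ M] [IsNoetherian Γ M] [IsArtinian Γ M] :
    ∃ n ≠ 0, IsCompl (LinearMap.ker ((hp.pow n).smulHom M))
      (LinearMap.range ((hp.pow n).smulHom M)) := by
  obtain ⟨a, ha⟩ := monotone_stabilizes_iff_noetherian.2 ‹IsNoetherian Γ M›
    ⟨_, hp.ker_smulHom_pow_mono⟩
  obtain ⟨b, hb⟩ := IsArtinian.monotone_stabilizes (R := Γ) (M := M)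
    ⟨_, hp.range_smulHom_pow_anti.dual_right⟩
  let n := a + b + 1
  have hker : LinearMap.ker ((hp.pow (n + n)).smulHom M) ≤ LinearMap.ker ((hp.pow n).smulHom M) :=
    ((ha (n + n) (by lia)).symm.trans (ha n (by lia))).le
  have hrange : LinearMap.range ((hp.pow n).smulHom M) ≤
      LinearMap.range ((hp.pow (n + n)).smulHom M) :=
    ((hb n (by lia)).symm.trans (hb (n + n) (by lia))).ge
  simp only [SetLike.le_def, LinearMap.mem_ker, LinearMap.mem_range, smulHom_apply, pow_add,
    mul_smul] at hker hrange
  refine ⟨n, by lia, Submodule.disjoint_def.2 ?_, codisjoint_iff.2 (eq_top_iff.2 fun x _ => ?_)⟩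
  · rintro _ hx ⟨t, rfl⟩
    exact hker hx
  · obtain ⟨t, ht⟩ := hrange ⟨x, rfl⟩
    refine Submodule.mem_sup.2 ⟨x - p ^ n • t, ?_, p ^ n • t, ⟨t, rfl⟩, sub_add_cancel _ _⟩
    rw [LinearMap.mem_ker, smulHom_apply, smul_sub, ht, sub_self]

end IsNormalElement

end NormalElement

theorem IsIndecomposableModule.exists_pow_succ_smul_eq_zero {Γ : Type u} [Ring Γ] {M : Type v}
    [AddCommGroup M] [Module Γ M] [IsNoetherian Γ M] [IsArtinian Γ M]
    (hM : IsIndecomposableModule Γ M) {p : Γ} (hp : IsNormalElement p) {x : M} (hx : x ≠ 0)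
    (hpx : p • x = 0) :
    ∃ n, (∀ m : M, p ^ (n + 1) • m = 0) ∧ ∃ m : M, p ^ n • m ≠ 0 := by
  obtain ⟨n, hn, hcompl⟩ := hp.exists_isCompl_ker_range M
  have hxn : x ∈ LinearMap.ker ((hp.pow n).smulHom M) :=
    hp.ker_smulHom_pow_mono (Nat.one_le_iff_ne_zero.2 hn) (by simpa using hpx)
  have hrange : LinearMap.range ((hp.pow n).smulHom M) = ⊥ :=
    (hM.2 _ _ hcompl).resolve_left fun h => hx (by simpa [h] using hxn)
  have hnil (m : M) : p ^ n • m = 0 := by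
    simpa [hrange] using LinearMap.mem_range_self ((hp.pow n).smulHom M) m
  have hzero : ¬ ∀ m : M, p ^ 0 • m = 0 := fun h => hx (by simpa using h x)
  obtain ⟨i, hi, hi'⟩ :=
    Nat.exists_not_and_succ_of_not_zero_of_exists (p := fun i => ∀ m : M, p ^ i • m = 0)
      hzero ⟨n, hnil⟩
  exact ⟨i, hi', not_forall.1 hi⟩

section Hollow

open IsNormalElement

variable {Γ : Type*} [Ring Γ] {p : Γ} {H : Type*} [AddCommGroup H] [Module Γ H]

theorem le_of_supIrred_top_of_isSemisimpleModule_quotient (hH : SupIrred (⊤ : Submodule Γ H))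
    {K : Submodule Γ H} [IsSemisimpleModule Γ (H ⧸ K)] {T : Submodule Γ H} (hT : T ≠ ⊤) :
    T ≤ K := by
  obtain ⟨Q, hQ⟩ := exists_isCompl (T.map K.mkQ)
  have hQmap : (Q.comap K.mkQ).map K.mkQ = Q :=
    Submodule.map_comap_eq_of_surjective K.mkQ_surjective Q
  have hsup : T ⊔ Q.comap K.mkQ = ⊤ := by
    have hK : K ≤ T ⊔ Q.comap K.mkQ :=
      (K.ker_mkQ.ge.trans (LinearMap.ker_le_comap _)).trans le_sup_right
    rw [← sup_eq_right.2 hK, ← Submodule.comap_map_mkQ, Submodule.map_sup, hQmap, hQ.sup_eq_top,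
      Submodule.comap_top]
  have hQtop : Q = ⊤ := by
    rw [← hQmap, (hH.2 hsup).resolve_left hT, Submodule.map_top, K.range_mkQ]
  rw [← K.ker_mkQ, LinearMap.le_ker_iff_map, ← disjoint_top, ← hQtop]
  exact hQ.disjoint

theorem exists_eq_range_smulHom_pow (hp : IsNormalElement p) (hH : SupIrred (⊤ : Submodule Γ H))
    [IsSemisimpleModule Γ (H ⧸ LinearMap.range (hp.smulHom H))] {n : ℕ} {T : Submodule Γ H}
    (hT : LinearMap.range ((hp.pow n).smulHom H) ≤ T) :
    ∃ i, T = LinearMap.range ((hp.pow i).smulHom H) := by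
  induction n generalizing T with
  | zero => exact ⟨0, (top_le_iff.1 fun x _ => hT ⟨x, by simp⟩).trans (by ext; simp)⟩
  | succ n ih =>
    by_cases hT' : T = ⊤
    · exact ⟨0, by ext; simp [hT']⟩
    have hle : T ≤ LinearMap.range (hp.smulHom H) :=
      le_of_supIrred_top_of_isSemisimpleModule_quotient hH hT'
    have hcomap : (T.comap (hp.smulHom H)).map (hp.smulHom H) = T :=
      Submodule.map_comap_eq_self hle
    obtain ⟨i, hi⟩ := ih (T := T.comap (hp.smulHom H)) <| by
      rintro _ ⟨x, rfl⟩
      refine hT ⟨x, ?_⟩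
      rw [smulHom_apply, pow_succ', mul_smul, smulHom_apply, smulHom_apply]
    refine ⟨i + 1, ?_⟩
    rw [← hcomap, hi]
    ext x
    simp [pow_succ', mul_smul]

end Hollow

section Bound

variable {Γ : Type*} [Ring Γ]

/-- An element `p` is a *bound* of the simple module `S` if it is nonzero, normal and kills `S`, and
if `Γ / Γ p` is a sum of copies of `S`. -/
structure IsBound (p : Γ) (S : Type*) [AddCommGroup S] [Module Γ S] : Prop where
  normal : IsNormalElement p
  ne_zero : p ≠ 0
  smul_eq_zero : ∀ s : S, p • s = 0
  isotypicComponent_eq_top : isotypicComponent Γ (Γ ⧸ Ideal.span {p}) S = ⊤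

namespace IsBound

variable {p : Γ} {S : Type*} [AddCommGroup S] [Module Γ S]

theorem congr {S' : Type*} [AddCommGroup S'] [Module Γ S'] (h : IsBound p S) (e : S ≃ₗ[Γ] S') :
    IsBound p S' where
  normal := h.normal
  ne_zero := h.ne_zero
  smul_eq_zero s := by rw [← e.apply_symm_apply s, ← map_smul, h.smul_eq_zero, map_zero]
  isotypicComponent_eq_top := e.isotypicComponent_eq.symm.trans h.isotypicComponent_eq_top

variable [IsSimpleModule Γ S] {M : Type*} [AddCommGroup M] [Module Γ M]

theorem isotypicComponent_eq_top_of_smul_eq_zero (h : IsBound p S) (hM : ∀ m : M, p • m = 0) :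
    isotypicComponent Γ M S = ⊤ := by
  refine top_le_iff.1 fun m _ => ?_
  have hp : Ideal.span {p} ≤ LinearMap.ker (LinearMap.toSpanSingleton Γ M m) := by
    rw [Ideal.span_singleton_le_iff_mem, LinearMap.mem_ker, LinearMap.toSpanSingleton_apply, hM]
  have hone := LinearMap.le_comap_isotypicComponent S ((Ideal.span {p}).liftQ _ hp)
    (h.isotypicComponent_eq_top.ge (Submodule.mem_top (x := Submodule.Quotient.mk 1)))
  simpa using hone

theorem isSemisimpleModule_of_smul_eq_zero (h : IsBound p S) (hM : ∀ m : M, p • m = 0) :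
    IsSemisimpleModule Γ M := by
  have htop : IsSemisimpleModule Γ (⊤ : Submodule Γ M) :=
    h.isotypicComponent_eq_top_of_smul_eq_zero hM ▸ inferInstance
  exact htop.congr Submodule.topEquiv.symm

theorem nonempty_linearEquiv_of_smul_eq_zero (h : IsBound p S) [IsSimpleModule Γ M]
    (hM : ∀ m : M, p • m = 0) : Nonempty (M ≃ₗ[Γ] S) := by
  have htop : IsSimpleModule Γ (⊤ : Submodule Γ M) := IsSimpleModule.congr Submodule.topEquiv
  obtain ⟨e⟩ := IsIsotypicOfType.of_isotypicComponent_eq_top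
    (h.isotypicComponent_eq_top_of_smul_eq_zero hM) (⊤ : Submodule Γ M)
  exact ⟨Submodule.topEquiv.symm.trans e⟩

end IsBound

theorem isotypicComponent_quotient_annihilator_eq_top (S : Type*) [AddCommGroup S] [Module Γ S]
    [IsSimpleModule Γ S] [IsArtinian Γ (Γ ⧸ Module.annihilator Γ S)] :
    isotypicComponent Γ (Γ ⧸ Module.annihilator Γ S) S = ⊤ := by
  let f (s : S) : Γ ⧸ Module.annihilator Γ S →ₗ[Γ] S :=
    (Module.annihilator Γ S).liftQ (LinearMap.toSpanSingleton Γ S s)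
      fun x hx => Module.mem_annihilator.1 hx s
  have eq_zero_of_forall (x : Γ ⧸ Module.annihilator Γ S) (hx : ∀ s, f s x = 0) : x = 0 := by
    obtain ⟨x, rfl⟩ := Submodule.Quotient.mk_surjective _ x
    exact (Submodule.Quotient.mk_eq_zero _).2 (Module.mem_annihilator.2 hx)
  -- The maps `f s` separate points, hence so do finitely many of them, by the Artinian property.
  obtain ⟨F, hF⟩ := Finset.exists_inf_le fun s => LinearMap.ker (f s)
  have hinj : Function.Injective (LinearMap.pi fun s : F => f s) := by
    refine LinearMap.ker_eq_bot.1 (LinearMap.ker_eq_bot'.2 fun x hx => eq_zero_of_forall x ?_)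
    have hx' : x ∈ F.inf fun s => LinearMap.ker (f s) := by
      rw [Submodule.mem_finsetInf]
      exact fun s hs => congrFun hx ⟨s, hs⟩
    exact fun s => hF s hx'
  have := IsSemisimpleModule.of_injective _ hinj
  refine isotypicComponent_eq_top_iff.2 fun N hN => ?_
  obtain ⟨n, hn⟩ := @exists_ne _ hN.nontrivial 0
  obtain ⟨s, hs⟩ : ∃ s, f s n ≠ 0 := by
    by_contra! h
    exact hn (Subtype.ext (eq_zero_of_forall n h))
  have hne : (f s).domRestrict N ≠ 0 := fun h => hs (LinearMap.congr_fun h n)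
  exact ⟨LinearEquiv.ofBijective _ (LinearMap.bijective_of_ne_zero hne)⟩

end Bound

section PrincipalIdealDomain

variable {Γ : Type*} [Ring Γ]

theorem isArtinian_quotient_span_mul (a b : Γ) [IsArtinian Γ (Γ ⧸ Ideal.span {a})]
    [IsArtinian Γ (Γ ⧸ Ideal.span {b})] : IsArtinian Γ (Γ ⧸ Ideal.span {a * b}) := by
  let f : (Γ ⧸ Ideal.span {a}) →ₗ[Γ] Γ ⧸ Ideal.span {a * b} :=
    Submodule.mapQ _ _ (LinearMap.toSpanSingleton Γ Γ b) <| by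
      rw [Ideal.span_singleton_le_iff_mem]
      exact Ideal.mem_span_singleton_self (a * b)
  let g : (Γ ⧸ Ideal.span {a * b}) →ₗ[Γ] Γ ⧸ Ideal.span {b} :=
    Submodule.mapQ _ _ LinearMap.id <| by
      rw [Ideal.span_singleton_le_iff_mem]
      exact Ideal.mul_mem_left _ a (Ideal.mem_span_singleton_self b)
  refine isArtinian_of_range_eq_ker f g ?_
  rw [Submodule.range_mapQ, Submodule.ker_mapQ, LinearMap.range_toSpanSingleton, Submodule.comap_id]

theorem isArtinian_quotient_span [IsDomain Γ] [IsPrincipalIdealRing Γ] [IsNoetherian Γᵐᵒᵖ Γ] {a : Γ}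
    (ha : a ≠ 0) : IsArtinian Γ (Γ ⧸ Ideal.span {a}) := by
  -- Noetherian induction on the right ideal `a Γ`: write `a = q b` with `Γ b` maximal, so that
  -- `a Γ < q Γ`.
  generalize hI : Submodule.span Γᵐᵒᵖ {a} = I
  induction I using IsNoetherian.induction generalizing a with
  | hgt I ih =>
    subst hI
    by_cases htop : Ideal.span {a} = ⊤
    · have := Submodule.Quotient.subsingleton_iff.2 htop
      infer_instance
    obtain ⟨m, hm, ham⟩ := Ideal.exists_le_maximal _ htop
    obtain ⟨b, rfl⟩ : ∃ b, m = Ideal.span {b} := (IsPrincipalIdealRing.principal m).principal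
    obtain ⟨q, rfl⟩ := Ideal.mem_span_singleton'.1 (ham (Ideal.mem_span_singleton_self a))
    have hq : q ≠ 0 := left_ne_zero_of_mul ha
    have : IsArtinian Γ (Γ ⧸ Ideal.span {q}) := by
      refine ih _ (lt_of_le_of_ne ?_ fun h => ?_) hq rfl
      · rw [Submodule.span_singleton_le_iff_mem]
        exact Submodule.smul_mem _ (MulOpposite.op b) (Submodule.mem_span_singleton_self q)
      · obtain ⟨y, hy⟩ :=
          Submodule.mem_span_singleton.1 (h.ge (Submodule.mem_span_singleton_self q))
        have hby : b * y.unop = 1 := mul_left_cancel₀ hq (by simpa [mul_assoc] using hy)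
        have hone : 1 ∈ Ideal.span {b} :=
          Ideal.mem_span_singleton'.2 ⟨y.unop, mul_eq_one_comm.1 hby⟩
        exact hm.ne_top ((Ideal.eq_top_iff_one _).2 hone)
    have : IsSimpleModule Γ (Γ ⧸ Ideal.span {b}) := isSimpleModule_iff_isCoatom.2 hm.out
    exact isArtinian_quotient_span_mul q b

end PrincipalIdealDomain

namespace IsBoundedPID

variable {Γ : Type u} [Ring Γ]

theorem isPrincipalIdealRing (hΓ : IsBoundedPID Γ) : IsPrincipalIdealRing Γ :=
  ⟨fun I => ⟨hΓ.left_principal I⟩⟩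

theorem isNoetherian_op (hΓ : IsBoundedPID Γ) : IsNoetherian Γᵐᵒᵖ Γ := by
  refine ⟨fun I => ?_⟩
  obtain ⟨a, rfl⟩ := hΓ.right_principal I
  exact Submodule.fg_span_singleton a

theorem exists_isNormalElement_span_eq (hΓ : IsBoundedPID Γ) {I : Ideal Γ} [I.IsTwoSided]
    (hI : I ≠ ⊥) : ∃ p ≠ 0, IsNormalElement p ∧ Ideal.span {p} = I := by
  -- A generator `b` of `I` as a left ideal and a generator `a` of `I` as a right ideal differ by
  -- a unit.
  have := hΓ.isDomain
  let J : Submodule Γᵐᵒᵖ Γ :=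
    { I.toAddSubmonoid with smul_mem' := fun x y hy => I.mul_mem_right x.unop hy }
  obtain ⟨a, ha⟩ := hΓ.right_principal J
  obtain ⟨b, hb⟩ := hΓ.left_principal I
  have mem_left {x : Γ} : x ∈ I ↔ ∃ y, y * b = x := hb ▸ Ideal.mem_span_singleton'
  have mem_right {x : Γ} : x ∈ I ↔ ∃ y, a * y = x := by
    change x ∈ J ↔ _
    rw [ha, Submodule.mem_span_singleton, MulOpposite.op_surjective.exists]
    rfl
  have haI : a ∈ I := mem_right.2 ⟨1, mul_one a⟩
  have hbI : b ∈ I := mem_left.2 ⟨1, one_mul b⟩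
  have hb0 : b ≠ 0 := by
    rintro rfl
    exact hI (hb.trans (Ideal.span_singleton_eq_bot.2 rfl))
  obtain ⟨v, hv⟩ := mem_right.1 hbI
  obtain ⟨t, ht⟩ := mem_left.1 haI
  obtain ⟨w, hw⟩ := mem_right.1 (I.mul_mem_left t haI)
  have hwv : w * v = 1 := by
    have ha0 : a ≠ 0 := by
      rintro rfl
      exact hb0 (hv.symm.trans (zero_mul v))
    apply mul_left_cancel₀ ha0
    rw [← mul_assoc, hw, mul_assoc, hv, ht, mul_one]
  have hbw : b * w = a := by rw [← hv, mul_assoc, mul_eq_one_comm.1 hwv, mul_one]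
  refine ⟨b, hb0, IsNormalElement.of_exists_mul_eq hb0 (fun x => ?_) (fun x => ?_), hb.symm⟩
  · exact mem_left.1 (I.mul_mem_right x hbI)
  · obtain ⟨y, hy⟩ := mem_right.1 (I.mul_mem_left x hbI)
    exact ⟨w * y, by rw [← mul_assoc, hbw, hy]⟩

theorem annihilator_ne_bot (hΓ : IsBoundedPID Γ) (hΓ' : ¬ IsSimpleModule Γ Γ) (S : Type*)
    [AddCommGroup S] [Module Γ S] [IsSimpleModule Γ S] : Module.annihilator Γ S ≠ ⊥ := by
  obtain ⟨I, hI, ⟨e⟩⟩ := isSimpleModule_iff_quot_maximal.1 ‹IsSimpleModule Γ S›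
  have hI0 : I ≠ ⊥ := by
    rintro rfl
    have : IsSimpleModule Γ (Γ ⧸ (⊥ : Ideal Γ)) := IsSimpleModule.congr e.symm
    exact hΓ' (IsSimpleModule.congr (Submodule.quotEquivOfEqBot ⊥ rfl).symm)
  obtain ⟨J, hJ, hJI⟩ := hΓ.left_bounded I hI0
  have hle : ∀ x ∈ J, x ∈ Module.annihilator Γ S := by
    intro x hx
    rw [e.annihilator_eq, Module.mem_annihilator]
    intro y
    obtain ⟨y, rfl⟩ := Submodule.Quotient.mk_surjective _ y
    exact (Submodule.Quotient.mk_eq_zero _).2 (hJI _ (J.mul_mem_right x y hx))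
  refine fun h => hJ (eq_bot_iff.2 fun x hx => ?_)
  simpa [h] using hle x hx

theorem exists_isBound (hΓ : IsBoundedPID Γ) (hΓ' : ¬ IsSimpleModule Γ Γ) (S : Type*)
    [AddCommGroup S] [Module Γ S] [IsSimpleModule Γ S] : ∃ p : Γ, IsBound p S := by
  have := hΓ.isDomain
  have := hΓ.isPrincipalIdealRing
  have := hΓ.isNoetherian_op
  obtain ⟨p, hp0, hp, hpS⟩ := hΓ.exists_isNormalElement_span_eq (hΓ.annihilator_ne_bot hΓ' S)
  have : IsArtinian Γ (Γ ⧸ Module.annihilator Γ S) := hpS ▸ isArtinian_quotient_span hp0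
  exact ⟨p, hp, hp0, Module.mem_annihilator.1 (hpS ▸ Ideal.mem_span_singleton_self p),
    hpS ▸ isotypicComponent_quotient_annihilator_eq_top S⟩

end IsBoundedPID

section Divisible

variable {Γ : Type*} [Ring Γ] {X : Type*} [AddCommGroup X] [Module Γ X]

theorem exists_smul_eq_of_baer [IsDomain Γ] (hX : Module.Baer Γ X) {a : Γ} (ha : a ≠ 0)
    (x : X) : ∃ y, a • y = x := by
  obtain ⟨f, hf⟩ := hX.extension_property (LinearMap.toSpanSingleton Γ Γ a)
    (fun b c hbc => mul_right_cancel₀ ha (by simpa using hbc)) (LinearMap.toSpanSingleton Γ X x)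
  exact ⟨f 1, by simpa [← map_smul] using LinearMap.congr_fun hf 1⟩

theorem baer_of_exists_smul_eq [IsPrincipalIdealRing Γ]
    (hX : ∀ a : Γ, a ≠ 0 → ∀ x : X, ∃ y, a • y = x) : Module.Baer Γ X := by
  intro I g
  obtain ⟨a, rfl⟩ : ∃ a, I = Ideal.span {a} := (IsPrincipalIdealRing.principal I).principal
  obtain ⟨y, hy⟩ : ∃ y, a • y = g ⟨a, Ideal.mem_span_singleton_self a⟩ := by
    by_cases ha : a = 0
    · refine ⟨0, ?_⟩
      rw [smul_zero, eq_comm, ← map_zero g]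
      exact congrArg g (Subtype.ext ha)
    · exact hX a ha _
  refine ⟨LinearMap.toSpanSingleton Γ X y, fun x hx => ?_⟩
  obtain ⟨b, rfl⟩ := Ideal.mem_span_singleton'.1 hx
  rw [LinearMap.toSpanSingleton_apply, mul_smul, hy, ← map_smul]
  rfl

theorem baer_quotient [IsDomain Γ] [IsPrincipalIdealRing Γ] (hX : Module.Baer Γ X)
    (C : Submodule Γ X) : Module.Baer Γ (X ⧸ C) := by
  refine baer_of_exists_smul_eq fun a ha x => ?_
  obtain ⟨x, rfl⟩ := C.mkQ_surjective x
  obtain ⟨y, rfl⟩ := exists_smul_eq_of_baer hX ha x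
  exact ⟨C.mkQ y, (map_smul _ _ _).symm⟩

end Divisible

/-- A module `X` with a submodule `S` is a *primary hull* of the simple module `S` with bound `p` if
it is an injective hull of `S` on which `p` acts surjectively. Injectivity is expressed by Baer's
criterion, which does not restrict the universe of the test modules. -/
structure IsPrimaryHull {Γ : Type u} [Ring Γ] (p : Γ) {X : Type*} [AddCommGroup X] [Module Γ X]
    (S : Submodule Γ X) : Prop where
  isBound : IsBound p S
  isMonolith : IsMonolith S
  smul_surjective : ∀ x : X, ∃ y, p • y = x
  baer : Module.Baer Γ X

theorem exists_isMonolith_baer {Γ : Type u} [Ring Γ] [IsDomain Γ] [IsPrincipalIdealRing Γ]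
    (S : Type*) [AddCommGroup S] [Module Γ S] [IsSimpleModule Γ S] :
    ∃ (X : Type u) (_ : AddCommGroup X) (_ : Module Γ X) (T : Submodule Γ X),
      IsMonolith T ∧ Module.Baer Γ X ∧ Nonempty (S ≃ₗ[Γ] T) := by
  obtain ⟨I, -, ⟨e⟩⟩ := isSimpleModule_iff_quot_maximal.1 ‹IsSimpleModule Γ S›
  obtain ⟨⟨X, hX, i, hi⟩⟩ :=
    CategoryTheory.EnoughInjectives.presentation (ModuleCat.of Γ (Γ ⧸ I))
  let f : S →ₗ[Γ] X := i.hom ∘ₗ e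
  have hf : Function.Injective f := ((ModuleCat.mono_iff_injective i).1 hi).comp e.injective
  let e' : S ≃ₗ[Γ] LinearMap.range f := LinearEquiv.ofInjective f hf
  have : IsSimpleModule Γ (LinearMap.range f) := IsSimpleModule.congr e'.symm
  obtain ⟨C, hCd, hC⟩ := exists_disjoint_isMonolith_map_mkQ (LinearMap.range f)
  have hker : LinearMap.ker (C.mkQ.domRestrict (LinearMap.range f)) = ⊥ := by
    rw [LinearMap.ker_domRestrict, C.ker_mkQ]
    exact Submodule.disjoint_iff_comap_eq_bot.1 hCd.symm
  refine ⟨X ⧸ C, inferInstance, inferInstance, _, hC, baer_quotient (.of_injective ?_) C, ⟨?_⟩⟩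
  · exact Module.injective_module_of_injective_object Γ X
  · exact (e'.trans (LinearEquiv.ofInjective _ (LinearMap.ker_eq_bot.1 hker))).trans
      (LinearEquiv.ofEq _ _ (LinearMap.range_domRestrict _ _))

theorem IsBoundedPID.exists_isPrimaryHull {Γ : Type u} [Ring Γ] (hΓ : IsBoundedPID Γ)
    (hΓ' : ¬ IsSimpleModule Γ Γ) (S : Type*) [AddCommGroup S] [Module Γ S] [IsSimpleModule Γ S] :
    ∃ (p : Γ) (X : Type u) (_ : AddCommGroup X) (_ : Module Γ X) (T : Submodule Γ X),
      IsPrimaryHull p T ∧ Nonempty (S ≃ₗ[Γ] T) := by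
  have := hΓ.isDomain
  have := hΓ.isPrincipalIdealRing
  obtain ⟨p, hp⟩ := hΓ.exists_isBound hΓ' S
  obtain ⟨X, _, _, T, hT, hX, ⟨e⟩⟩ := exists_isMonolith_baer (Γ := Γ) S
  exact ⟨p, X, _, _, T, ⟨hp.congr e, hT, exists_smul_eq_of_baer hX hp.ne_zero, hX⟩, ⟨e⟩⟩

namespace IsPrimaryHull

variable {Γ : Type u} [Ring Γ] {p : Γ} {X : Type*} [AddCommGroup X] [Module Γ X]
  {S : Submodule Γ X}

theorem exists_pow_smul_eq (h : IsPrimaryHull p S) (n : ℕ) (x : X) : ∃ y, p ^ n • y = x := by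
  induction n with
  | zero => exact ⟨x, by simp⟩
  | succ n ih =>
    obtain ⟨y, rfl⟩ := ih
    obtain ⟨z, rfl⟩ := h.smul_surjective y
    exact ⟨z, by rw [pow_succ, mul_smul]⟩

/-- The `n`-th *layer* of a primary hull `X`: the kernel of `p ^ n` on `X`. For `n ≠ 0` it
is the indecomposable module of length `n` with socle `S`. -/
noncomputable def layer (h : IsPrimaryHull p S) (n : ℕ) : Submodule Γ X :=
  LinearMap.ker ((h.isBound.normal.pow n).smulHom X)

variable (h : IsPrimaryHull p S) {n : ℕ}

theorem mem_layer {x : X} : x ∈ h.layer n ↔ p ^ n • x = 0 :=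
  Iff.rfl

theorem pow_smul_layer (x : h.layer n) : p ^ n • x = 0 :=
  Subtype.ext x.2

theorem layer_mono : Monotone h.layer :=
  h.isBound.normal.ker_smulHom_pow_mono

theorem layer_zero : h.layer 0 = ⊥ := by
  ext x
  rw [mem_layer, pow_zero, one_smul, Submodule.mem_bot]

theorem layer_one : h.layer 1 = S := by
  have := h.isMonolith.isSimpleModule
  have : IsSemisimpleModule Γ (h.layer 1) :=
    h.isBound.isSemisimpleModule_of_smul_eq_zero fun x => by simpa using h.pow_smul_layer x
  refine le_antisymm (h.isMonolith.le_of_isSemisimpleModule _) fun s hs => ?_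
  rw [mem_layer, pow_one]
  exact congrArg Subtype.val (h.isBound.smul_eq_zero ⟨s, hs⟩)

include h in
theorem mem_iff_smul_eq_zero {x : X} : x ∈ S ↔ p • x = 0 := by
  rw [← h.layer_one, mem_layer, pow_one]

theorem le_layer (hn : n ≠ 0) : S ≤ h.layer n :=
  h.layer_one.ge.trans (h.layer_mono (Nat.one_le_iff_ne_zero.2 hn))

theorem not_layer_succ_le (n : ℕ) : ¬ h.layer (n + 1) ≤ h.layer n := by
  intro hle
  refine h.isMonolith.1 ((Submodule.eq_bot_iff S).2 fun s hs => ?_)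
  obtain ⟨y, rfl⟩ := h.exists_pow_smul_eq n s
  refine hle ?_
  rwa [mem_layer, pow_succ', mul_smul, ← h.mem_iff_smul_eq_zero]

theorem eq_layer {T : Submodule Γ X} (hT : T ≤ h.layer (n + 1)) (hT' : ¬ T ≤ h.layer n) :
    T = h.layer (n + 1) := by
  have hST : S ≤ T := h.isMonolith.le fun hbot => hT' (hbot.trans_le bot_le)
  induction n generalizing T with
  | zero => exact hT.antisymm (h.layer_one.trans_le hST)
  | succ n ih =>
    let φ := h.isBound.normal.smulHom X
    have hφ {m : ℕ} {x : X} : φ x ∈ h.layer m ↔ x ∈ h.layer (m + 1) := by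
      rw [mem_layer, mem_layer, pow_succ, mul_smul]
      rfl
    have hmap : T.map φ = h.layer (n + 1) := by
      have hmap' : ¬ T.map φ ≤ h.layer n :=
        fun hle => hT' fun t ht => hφ.1 (hle ⟨t, ht, rfl⟩)
      refine ih ?_ hmap' (h.isMonolith.le fun hbot => hmap' (hbot.trans_le bot_le))
      rintro _ ⟨t, ht, rfl⟩
      exact hφ.2 (hT ht)
    refine hT.antisymm fun x hx => ?_
    obtain ⟨t, ht, htx⟩ := hmap.ge (hφ.2 hx)
    have hsub : x - t ∈ S := by
      rw [h.mem_iff_smul_eq_zero, smul_sub, sub_eq_zero]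
      exact htx.symm
    simpa using T.add_mem (hST hsub) ht

theorem layer_covBy (n : ℕ) : h.layer n ⋖ h.layer (n + 1) :=
  ⟨lt_of_le_not_ge (h.layer_mono n.le_succ) (h.not_layer_succ_le n),
    fun _ hT hT' => hT'.ne (h.eq_layer hT'.le hT.not_ge)⟩

theorem supIrred_layer_succ (n : ℕ) : SupIrred (h.layer (n + 1)) := by
  refine ⟨fun hmin => h.not_layer_succ_le n ((isMin_iff_eq_bot.1 hmin).trans_le bot_le),
    fun A B hAB => ?_⟩
  by_contra! hne
  have hle : A ≤ h.layer (n + 1) ∧ B ≤ h.layer (n + 1) := sup_le_iff.1 hAB.le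
  have hA : A ≤ h.layer n := by
    by_contra hA
    exact hne.1 (h.eq_layer hle.1 hA)
  have hB : B ≤ h.layer n := by
    by_contra hB
    exact hne.2 (h.eq_layer hle.2 hB)
  exact h.not_layer_succ_le n (hAB.ge.trans (sup_le hA hB))

theorem length_layer (n : ℕ) : Module.length Γ (h.layer n) = n := by
  induction n with
  | zero =>
    rw [h.layer_zero, Nat.cast_zero, Module.length_eq_zero_iff]
    infer_instance
  | succ n ih =>
    have hle : h.layer n ≤ h.layer (n + 1) := (h.layer_covBy n).le
    have : IsSimpleModule Γ (h.layer (n + 1) ⧸ (h.layer n).submoduleOf (h.layer (n + 1))) :=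
      (covBy_iff_quot_is_simple hle).1 (h.layer_covBy n)
    have hexact : Function.Exact (Submodule.inclusion hle)
        ((h.layer n).submoduleOf (h.layer (n + 1))).mkQ := by
      rw [LinearMap.exact_iff, Submodule.ker_mkQ, Submodule.range_inclusion, Submodule.submoduleOf]
    rw [Module.length_eq_add_of_exact _ _ (Submodule.inclusion_injective hle)
      (Submodule.mkQ_surjective _) hexact, ih, Nat.cast_succ]
    exact congrArg _ (Module.length_eq_one Γ _)

theorem isMonolith_submoduleOf_layer (hn : n ≠ 0) : IsMonolith (S.submoduleOf (h.layer n)) :=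
  h.isMonolith.submoduleOf (h.le_layer hn)

theorem isIndecomposableModule_layer (hn : n ≠ 0) : IsIndecomposableModule Γ (h.layer n) :=
  (h.isMonolith_submoduleOf_layer hn).isIndecomposableModule

theorem moduleSocle_layer (hn : n ≠ 0) :
    moduleSocle Γ (h.layer n) = S.submoduleOf (h.layer n) :=
  (h.isMonolith_submoduleOf_layer hn).moduleSocle_eq

theorem nonempty_moduleSocle_layer_equiv (hn : n ≠ 0) :
    Nonempty (moduleSocle Γ (h.layer n) ≃ₗ[Γ] S) :=
  ⟨(LinearEquiv.ofEq _ _ (h.moduleSocle_layer hn)).trans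
    (Submodule.submoduleOfEquivOfLe (h.le_layer hn))⟩

theorem exists_extension_layer (f : Module.End Γ (S.submoduleOf (h.layer n))) :
    ∃ g : Module.End Γ (h.layer n), ∀ x : S.submoduleOf (h.layer n), g x = f x := by
  obtain ⟨g, hg⟩ := h.baer.extension_property (S.submoduleOf (h.layer n)).subtype
    (Submodule.injective_subtype _)
    ((h.layer n).subtype ∘ₗ (S.submoduleOf (h.layer n)).subtype ∘ₗ f)
  refine ⟨g.codRestrict (h.layer n) fun x => ?_, fun x => Subtype.ext (LinearMap.congr_fun hg x)⟩
  rw [mem_layer, ← map_smul, h.pow_smul_layer, map_zero]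

theorem length_layer_eq_mul (R : Type*) [Ring R] [Module R (h.layer n)]
    [SMulCommClass Γ R (h.layer n)] :
    Module.length R (h.layer n) =
      n * Module.length R (LinearMap.ker (Module.toModuleEnd R (S := Γ) (h.layer n) p)) := by
  refine length_eq_mul_length_ker ?_ fun i hi x hx => ?_
  · rw [← map_pow]
    exact LinearMap.ext h.pow_smul_layer
  · obtain ⟨y, hy⟩ := h.exists_pow_smul_eq i (x : X)
    have hyn : y ∈ h.layer n := by
      refine h.layer_mono (Nat.succ_le_of_lt hi) ?_
      rw [mem_layer, pow_succ', mul_smul, hy]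
      exact congrArg Subtype.val hx
    refine ⟨⟨y, hyn⟩, ?_⟩
    rw [← map_pow]
    exact Subtype.ext hy

theorem mem_ker_toModuleEnd_iff {R : Type*} [Ring R] [Module R (h.layer n)]
    [SMulCommClass Γ R (h.layer n)] {x : h.layer n} :
    x ∈ LinearMap.ker (Module.toModuleEnd R (S := Γ) (h.layer n) p) ↔
      x ∈ S.submoduleOf (h.layer n) :=
  Subtype.ext_iff.trans h.mem_iff_smul_eq_zero.symm

theorem endolength_layer (n : ℕ) :
    endolength Γ (h.layer n) = n * endolength Γ (S.submoduleOf (h.layer n)) := by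
  rw [endolength, h.length_layer_eq_mul,
    length_eq_endolength (fun _ => h.mem_ker_toModuleEnd_iff) h.exists_extension_layer]

end IsPrimaryHull

namespace IsPrimaryHull

variable {Γ : Type u} [Ring Γ] {p : Γ} {X : Type*} [AddCommGroup X] [Module Γ X]
  {S : Submodule Γ X} (h : IsPrimaryHull p S) {M : Type v} [AddCommGroup M] [Module Γ M] {n : ℕ}

theorem range_le_layer (hM : ∀ m : M, p ^ n • m = 0) (f : M →ₗ[Γ] X) :
    LinearMap.range f ≤ h.layer n := by
  rintro _ ⟨m, rfl⟩
  rw [mem_layer, ← map_smul, hM, map_zero]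

theorem exists_range_eq_layer [IsArtinian Γ M] (hM : ∀ m : M, p ^ (n + 1) • m = 0)
    (hM' : ∃ m : M, p ^ n • m ≠ 0) : ∃ f : M →ₗ[Γ] X, LinearMap.range f = h.layer (n + 1) := by
  let L : Submodule Γ M := LinearMap.range ((h.isBound.normal.pow n).smulHom M)
  have hL : L ≠ ⊥ := fun hL => hM'.elim fun m hm => hm ((Submodule.eq_bot_iff L).1 hL _ ⟨m, rfl⟩)
  obtain ⟨A, hA, hAL⟩ := (eq_bot_or_exists_atom_le L).resolve_left hL
  have : IsSimpleModule Γ A := isSimpleModule_iff_isAtom.2 hA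
  have := h.isMonolith.isSimpleModule
  have hpA (a : A) : p • a = 0 := by
    obtain ⟨m, hm⟩ := hAL a.2
    exact Subtype.ext ((congrArg (p • ·) hm.symm).trans (by simpa [pow_succ', mul_smul] using hM m))
  obtain ⟨e⟩ := h.isBound.nonempty_linearEquiv_of_smul_eq_zero hpA
  obtain ⟨f, hf⟩ := h.baer.extension_property A.subtype A.subtype_injective (S.subtype ∘ₗ e)
  refine ⟨f, h.eq_layer (h.range_le_layer hM f) fun hle => hA.1 ?_⟩
  refine (Submodule.eq_bot_iff A).2 fun a ha => ?_
  obtain ⟨m, rfl⟩ := hAL ha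
  have hzero : e ⟨_, ha⟩ = 0 := by
    refine Subtype.ext ((LinearMap.congr_fun hf ⟨_, ha⟩).symm.trans ?_)
    exact (map_smul f _ _).trans (h.mem_layer.1 (hle ⟨m, rfl⟩))
  exact congrArg Subtype.val (e.map_eq_zero_iff.1 hzero)

theorem injective_of_supIrred_top {H : Type*} [AddCommGroup H] [Module Γ H]
    (hH : SupIrred (⊤ : Submodule Γ H)) (hpH : ∀ x : H, p ^ (n + 1) • x = 0) {f : H →ₗ[Γ] X}
    (hf : LinearMap.range f = h.layer (n + 1)) : Function.Injective f := by
  have hp := h.isBound.normal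
  have := h.isMonolith.isSimpleModule
  have : IsSemisimpleModule Γ (H ⧸ LinearMap.range (hp.smulHom H)) := by
    refine h.isBound.isSemisimpleModule_of_smul_eq_zero fun x => ?_
    obtain ⟨x, rfl⟩ := Submodule.Quotient.mk_surjective _ x
    exact (Submodule.Quotient.mk_eq_zero _).2 ⟨x, rfl⟩
  have hbot : LinearMap.range ((hp.pow (n + 1)).smulHom H) ≤ LinearMap.ker f := by
    rintro _ ⟨x, rfl⟩
    exact (congrArg f (hpH x)).trans f.map_zero
  obtain ⟨i, hi⟩ := exists_eq_range_smulHom_pow hp hH hbot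
  have hni : n + 1 ≤ i := by
    by_contra! hin
    refine h.not_layer_succ_le n (le_trans ?_ (h.layer_mono (Nat.le_of_lt_succ hin)))
    rw [← hf]
    rintro _ ⟨x, rfl⟩
    have hx : p ^ i • x ∈ LinearMap.ker f := hi.ge ⟨x, rfl⟩
    rwa [mem_layer, ← map_smul]
  refine LinearMap.ker_eq_bot.1 (hi.trans (eq_bot_iff.2 ?_))
  refine (hp.range_smulHom_pow_anti hni).trans ?_
  rintro _ ⟨x, rfl⟩
  exact hpH x

theorem exists_isCompl_ker [IsArtinian Γ M] (hM : ∀ m : M, p ^ (n + 1) • m = 0)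
    {f : M →ₗ[Γ] X} (hf : LinearMap.range f = h.layer (n + 1)) :
    ∃ W : Submodule Γ M, IsCompl W (LinearMap.ker f) := by
  obtain ⟨W, hW, hWf⟩ := exists_supIrred_map_eq f (h.supIrred_layer_succ n) hf.ge
  have hinj : Function.Injective (f.domRestrict W) :=
    h.injective_of_supIrred_top (supIrred_top_submodule hW) (fun w => Subtype.ext (hM w))
      ((LinearMap.range_domRestrict _ _).trans hWf)
  refine ⟨W, Submodule.disjoint_iff_comap_eq_bot.2 ?_, ?_⟩
  · exact (LinearMap.ker_domRestrict W f).symm.trans (LinearMap.ker_eq_bot.2 hinj)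
  · rw [codisjoint_iff, ← Submodule.comap_map_eq, hWf, ← hf, eq_top_iff]
    exact fun m _ => LinearMap.mem_range_self f m

theorem nonempty_linearEquiv_layer (hM : IsIndecomposableModule Γ M)
    (hn : Module.length Γ M = n) {f : S →ₗ[Γ] M} (hf : f ≠ 0) :
    Nonempty (M ≃ₗ[Γ] h.layer n) := by
  obtain ⟨_, _⟩ := isNoetherian_and_isArtinian_of_length_eq hn
  obtain ⟨s, hs⟩ : ∃ s, f s ≠ 0 := by
    by_contra! hzero
    exact hf (LinearMap.ext hzero)
  have hps : p • f s = 0 := by rw [← map_smul, h.isBound.smul_eq_zero, map_zero]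
  obtain ⟨i, hM0, hM1⟩ := hM.exists_pow_succ_smul_eq_zero h.isBound.normal hs hps
  obtain ⟨g, hg⟩ := h.exists_range_eq_layer hM0 hM1
  obtain ⟨W, hW⟩ := h.exists_isCompl_ker hM0 hg
  have hker : LinearMap.ker g = ⊥ := by
    refine (hM.2 _ _ hW).resolve_left ?_
    rintro rfl
    have hg0 : g = 0 := LinearMap.ker_eq_top.1 (eq_top_of_bot_isCompl hW)
    exact (h.supIrred_layer_succ i).ne_bot (hg.symm.trans (LinearMap.range_eq_bot.2 hg0))
  let e : M ≃ₗ[Γ] h.layer (i + 1) :=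
    (LinearEquiv.ofInjective g (LinearMap.ker_eq_bot.1 hker)).trans (LinearEquiv.ofEq _ _ hg)
  obtain rfl : i + 1 = n := by
    exact_mod_cast (h.length_layer _).symm.trans (e.length_eq.symm.trans hn)
  exact ⟨e⟩

end IsPrimaryHull

section FiniteDimensional

variable {k : Type*} [CommRing k] {Γ : Type u} [Ring Γ] [Algebra k Γ]

theorem finite_restrictScalars_of_injective [IsNoetherianRing k] {M N : Type*} [AddCommGroup M]
    [Module Γ M] [AddCommGroup N] [Module Γ N] (f : M →ₗ[Γ] N) (hf : Function.Injective f)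
    (hN : Module.Finite k (RestrictScalars k Γ N)) :
    Module.Finite k (RestrictScalars k Γ M) := by
  let _ := Module.restrictScalars k Γ M
  let _ := Module.restrictScalars k Γ N
  have := IsScalarTower.restrictScalars k Γ M
  have := IsScalarTower.restrictScalars k Γ N
  have : Module.Finite k N := hN
  exact Module.Finite.of_injective (f.restrictScalars k) hf

variable [IsArtinianRing k]

theorem isNoetherian_and_isArtinian_of_finite {M : Type*} [AddCommGroup M] [Module Γ M]
    (hM : Module.Finite k (RestrictScalars k Γ M)) : IsNoetherian Γ M ∧ IsArtinian Γ M := by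
  let _ := Module.restrictScalars k Γ M
  have := IsScalarTower.restrictScalars k Γ M
  have : Module.Finite k M := hM
  exact ⟨isNoetherian_of_tower k inferInstance, isArtinian_of_tower k inferInstance⟩

theorem IsPrimaryHull.finite_layer {p : Γ} {X : Type*} [AddCommGroup X] [Module Γ X]
    {S : Submodule Γ X} (h : IsPrimaryHull p S) (hS : Module.Finite k (RestrictScalars k Γ S))
    (n : ℕ) : Module.Finite k (RestrictScalars k Γ (h.layer n)) := by
  let _ := Module.restrictScalars k Γ X
  have := IsScalarTower.restrictScalars k Γ X
  have : Module.Finite k S := hS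
  let K := LinearMap.ker (Module.toModuleEnd k (S := Γ) (h.layer n) p)
  let f : K →ₗ[k] S :=
    { toFun := fun x => ⟨x.1.1, h.mem_ker_toModuleEnd_iff.1 x.2⟩
      map_add' := fun _ _ => rfl
      map_smul' := fun _ _ => rfl }
  have hf : Function.Injective f := fun _ _ hxy =>
    Subtype.ext (Subtype.ext (congrArg (fun s : S => (s : X)) hxy))
  have : Module.Finite k K := Module.Finite.of_injective f hf
  have hK : Module.length k K ≠ ⊤ := Module.length_ne_top
  have hlength : Module.length k (h.layer n) ≠ ⊤ := by
    rw [h.length_layer_eq_mul]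
    exact WithTop.mul_ne_top (ENat.natCast_ne_top n) hK
  have := (isFiniteLength_iff_isNoetherian_isArtinian.1 (Module.length_ne_top_iff.1 hlength)).1
  exact inferInstanceAs (Module.Finite k (h.layer n))

end FiniteDimensional

section Simple

variable {Γ : Type u} [Ring Γ] {M : Type v} [AddCommGroup M] [Module Γ M]

theorem isMonolith_top [IsSimpleModule Γ M] : IsMonolith (⊤ : Submodule Γ M) :=
  ⟨top_ne_bot, fun T hT => ((eq_bot_or_eq_top T).resolve_left hT).ge⟩

theorem IsIndecomposableModule.isSimpleModule [IsSemisimpleModule Γ M]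
    (hM : IsIndecomposableModule Γ M) : IsSimpleModule Γ M := by
  have := hM.1
  refine (isSimpleModule_iff Γ M).2 { eq_bot_or_eq_top := fun A => ?_ }
  obtain ⟨B, hB⟩ := exists_isCompl A
  refine (hM.2 A B hB).imp_right fun hB0 => ?_
  exact eq_top_of_isCompl_bot (hB0 ▸ hB)

theorem nonempty_linearEquiv_self [IsSimpleModule Γ Γ] (M : Type*) [AddCommGroup M]
    [Module Γ M] [IsSimpleModule Γ M] : Nonempty (Γ ≃ₗ[Γ] M) := by
  have := IsSimpleModule.nontrivial Γ M
  obtain ⟨m, hm⟩ := exists_ne (0 : M)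
  have hne : LinearMap.toSpanSingleton Γ M m ≠ 0 := fun h => hm (by simpa using congr($h 1))
  exact ⟨LinearEquiv.ofBijective _ (LinearMap.bijective_of_ne_zero hne)⟩

end Simple

namespace IsBoundedPID

variable {Γ : Type u} [Ring Γ] (hΓ : IsBoundedPID Γ) {M : Type*} [AddCommGroup M] [Module Γ M]
  {n : ℕ}

include hΓ

theorem exists_linearEquiv_layer (hΓ' : ¬ IsSimpleModule Γ Γ) (hM : IsIndecomposableModule Γ M)
    (hn : Module.length Γ M = n) :
    ∃ (p : Γ) (X : Type u) (_ : AddCommGroup X) (_ : Module Γ X) (S : Submodule Γ X)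
      (h : IsPrimaryHull p S), n ≠ 0 ∧ Nonempty (M ≃ₗ[Γ] h.layer n) := by
  obtain ⟨_, _⟩ := isNoetherian_and_isArtinian_of_length_eq hn
  have := hM.1
  have hn0 : n ≠ 0 := by
    rintro rfl
    exact Module.length_pos.ne' hn
  obtain ⟨A, hA, -⟩ := (eq_bot_or_exists_atom_le (⊤ : Submodule Γ M)).resolve_left top_ne_bot
  have : IsSimpleModule Γ A := isSimpleModule_iff_isAtom.2 hA
  obtain ⟨p, X, _, _, S, h, ⟨e⟩⟩ := hΓ.exists_isPrimaryHull hΓ' A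
  refine ⟨p, X, _, _, S, h, hn0,
    h.nonempty_linearEquiv_layer hM hn (f := A.subtype ∘ₗ e.symm) fun hzero => ?_⟩
  have := IsSimpleModule.nontrivial Γ A
  obtain ⟨a, ha⟩ := exists_ne (0 : A)
  exact ha (Subtype.ext (by simpa using LinearMap.congr_fun hzero (e a)))

theorem isSimpleModule_moduleSocle (hM : IsIndecomposableModule Γ M)
    (hn : Module.length Γ M = n) : IsSimpleModule Γ (moduleSocle Γ M) := by
  by_cases hΓ' : IsSimpleModule Γ Γ
  · have := hM.isSimpleModule
    have hM : IsMonolith (⊤ : Submodule Γ M) := isMonolith_top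
    exact hM.moduleSocle_eq ▸ hM.isSimpleModule
  · obtain ⟨p, X, _, _, S, h, hn0, ⟨e⟩⟩ := hΓ.exists_linearEquiv_layer hΓ' hM hn
    obtain ⟨e'⟩ := nonempty_moduleSocle_equiv e
    obtain ⟨e''⟩ := h.nonempty_moduleSocle_layer_equiv hn0
    have := h.isMonolith.isSimpleModule
    exact IsSimpleModule.congr (e'.trans e'')

theorem endolength_eq (hM : IsIndecomposableModule Γ M) (hn : Module.length Γ M = n) :
    endolength Γ M = n * endolength Γ (moduleSocle Γ M) := by
  by_cases hΓ' : IsSimpleModule Γ Γ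
  · have := hM.isSimpleModule
    rw [← hn, Module.length_eq_one, one_mul, isMonolith_top.moduleSocle_eq]
    exact endolength_congr Submodule.topEquiv.symm
  · obtain ⟨p, X, _, _, S, h, hn0, ⟨e⟩⟩ := hΓ.exists_linearEquiv_layer hΓ' hM hn
    obtain ⟨e'⟩ := nonempty_moduleSocle_equiv e
    rw [endolength_congr e, endolength_congr e', h.moduleSocle_layer hn0, h.endolength_layer]

theorem nonempty_linearEquiv_of_moduleSocle {N : Type*} [AddCommGroup N] [Module Γ N]
    (hM : IsIndecomposableModule Γ M) (hnM : Module.length Γ M = n)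
    (hN : IsIndecomposableModule Γ N) (hnN : Module.length Γ N = n)
    (e : moduleSocle Γ M ≃ₗ[Γ] moduleSocle Γ N) : Nonempty (M ≃ₗ[Γ] N) := by
  by_cases hΓ' : IsSimpleModule Γ Γ
  · have := hM.isSimpleModule
    have := hN.isSimpleModule
    obtain ⟨eM⟩ := nonempty_linearEquiv_self (Γ := Γ) M
    obtain ⟨eN⟩ := nonempty_linearEquiv_self (Γ := Γ) N
    exact ⟨eM.symm.trans eN⟩
  · obtain ⟨p, X, _, _, S, h, hn0, ⟨eM⟩⟩ := hΓ.exists_linearEquiv_layer hΓ' hM hnM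
    obtain ⟨e₁⟩ := nonempty_moduleSocle_equiv eM
    obtain ⟨e₂⟩ := h.nonempty_moduleSocle_layer_equiv hn0
    let f : S ≃ₗ[Γ] moduleSocle Γ N := (e₂.symm.trans e₁.symm).trans e
    have := h.isMonolith.isSimpleModule.nontrivial
    obtain ⟨s, hs⟩ := exists_ne (0 : S)
    have hf : (moduleSocle Γ N).subtype ∘ₗ f.toLinearMap ≠ 0 := fun hzero =>
      hs (by simpa using LinearMap.congr_fun hzero s)
    obtain ⟨eN⟩ := h.nonempty_linearEquiv_layer hN hnN hf
    exact ⟨eM.trans eN.symm⟩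

theorem exists_isIndecomposableModule (hΓ' : ¬ IsSimpleModule Γ Γ) (S : Type*) [AddCommGroup S]
    [Module Γ S] [IsSimpleModule Γ S] (hn : n ≠ 0) :
    ∃ (M : Type u) (_ : AddCommGroup M) (_ : Module Γ M),
      IsIndecomposableModule Γ M ∧ Module.length Γ M = n ∧
        Nonempty (moduleSocle Γ M ≃ₗ[Γ] S) := by
  obtain ⟨p, X, _, _, T, h, ⟨e⟩⟩ := hΓ.exists_isPrimaryHull hΓ' S
  obtain ⟨e'⟩ := h.nonempty_moduleSocle_layer_equiv hn
  exact ⟨h.layer n, _, _, h.isIndecomposableModule_layer hn, h.length_layer n, ⟨e'.trans e.symm⟩⟩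

theorem finite_of_finite_moduleSocle {k : Type*} [CommRing k] [IsArtinianRing k] [Algebra k Γ]
    (hM : IsIndecomposableModule Γ M) (hn : Module.length Γ M = n)
    (hfin : Module.Finite k (RestrictScalars k Γ (moduleSocle Γ M))) :
    Module.Finite k (RestrictScalars k Γ M) := by
  by_cases hΓ' : IsSimpleModule Γ Γ
  · have := hM.isSimpleModule
    rw [isMonolith_top.moduleSocle_eq] at hfin
    exact finite_restrictScalars_of_injective _ Submodule.topEquiv.symm.injective hfin
  · obtain ⟨p, X, _, _, S, h, hn0, ⟨e⟩⟩ := hΓ.exists_linearEquiv_layer hΓ' hM hn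
    obtain ⟨e₁⟩ := nonempty_moduleSocle_equiv e
    obtain ⟨e₂⟩ := h.nonempty_moduleSocle_layer_equiv hn0
    refine finite_restrictScalars_of_injective e.toLinearMap e.injective (h.finite_layer ?_ n)
    exact finite_restrictScalars_of_injective (e₂.symm.trans e₁.symm).toLinearMap
      (e₂.symm.trans e₁.symm).injective hfin

end IsBoundedPID

section Isoclasses

open CategoryTheory

/-- The isomorphism classes of finite-dimensional indecomposable modules of length `n` whose socle
has endolength `e`. Over a bounded principal ideal domain they have endolength `n * e`. -/
def indecIsoclassesOfLength (k : Type v) (Γ : Type u) [Field k] [Ring Γ] [Algebra k Γ]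
    (n e : ℕ) : Set (Quotient (isIsomorphicSetoid (ModuleCat.{u} Γ))) :=
  {c | ∃ M : ModuleCat.{u} Γ, Module.Finite k (RestrictScalars k Γ M) ∧
    IsIndecomposableModule Γ M ∧ Module.length Γ M = n ∧ endolength Γ (moduleSocle Γ M) = e ∧
    Quotient.mk _ M = c}

/-- The operation on isomorphism classes of modules which is induced by the socle. -/
def socleClass {Γ : Type u} [Ring Γ] :
    Quotient (isIsomorphicSetoid (ModuleCat.{u} Γ)) →
      Quotient (isIsomorphicSetoid (ModuleCat.{u} Γ)) :=
  Quotient.map (fun M => ModuleCat.of Γ (moduleSocle Γ M)) fun _ _ ⟨i⟩ =>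
    (nonempty_moduleSocle_equiv i.toLinearEquiv).map LinearEquiv.toModuleIso

variable {k : Type v} [Field k] {Γ : Type u} [Ring Γ] [Algebra k Γ]

theorem subsingleton_indecIsoclasses [IsSimpleModule Γ Γ] (d : ℕ) :
    (indecIsoclasses k Γ d).Subsingleton := by
  rintro _ ⟨M, -, hM, -, rfl⟩ _ ⟨N, -, hN, -, rfl⟩
  have := hM.isSimpleModule
  have := hN.isSimpleModule
  obtain ⟨eM⟩ := nonempty_linearEquiv_self (Γ := Γ) M
  obtain ⟨eN⟩ := nonempty_linearEquiv_self (Γ := Γ) N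
  exact Quotient.sound ⟨(eM.symm.trans eN).toModuleIso⟩

theorem indecIsoclasses_zero : indecIsoclasses k Γ 0 = ∅ := by
  refine Set.eq_empty_of_forall_notMem ?_
  rintro _ ⟨M, -, hM, hM0, -⟩
  have := hM.1
  exact Module.length_pos.ne' hM0

namespace IsBoundedPID

variable (hΓ : IsBoundedPID Γ)

include hΓ

theorem indecIsoclassesOfLength_subset (n e : ℕ) :
    indecIsoclassesOfLength k Γ n e ⊆ indecIsoclasses k Γ (n * e) := by
  rintro _ ⟨M, hfin, hM, hn, he, rfl⟩
  exact ⟨M, hfin, hM, by rw [hΓ.endolength_eq hM hn, he, Nat.cast_mul], rfl⟩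

theorem indecIsoclasses_subset {d : ℕ} (hd : d ≠ 0) :
    indecIsoclasses k Γ d ⊆
      ⋃ x ∈ d.divisorsAntidiagonal, indecIsoclassesOfLength k Γ x.1 x.2 := by
  rintro _ ⟨M, hfin, hM, hMd, rfl⟩
  obtain ⟨_, _⟩ := isNoetherian_and_isArtinian_of_finite hfin
  obtain ⟨n, hn⟩ := exists_length_eq_natCast (R := Γ) (M := M)
  have hE : (d : ℕ∞) = n * endolength Γ (moduleSocle Γ M) :=
    hMd.symm.trans (hΓ.endolength_eq hM hn)
  have hn0 : (n : ℕ∞) ≠ 0 := by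
    have := hM.1
    exact hn ▸ Module.length_pos.ne'
  have htop : endolength Γ (moduleSocle Γ M) ≠ ⊤ := by
    intro htop
    rw [htop, ENat.mul_top hn0] at hE
    exact ENat.natCast_ne_top d hE
  obtain ⟨e, he⟩ := ENat.ne_top_iff_exists.1 htop
  have hne : n * e = d := by exact_mod_cast he ▸ hE.symm
  exact Set.mem_biUnion (x := (n, e)) (Nat.mem_divisorsAntidiagonal.2 ⟨hne, hd⟩)
    ⟨M, hfin, hM, hn, he.symm, rfl⟩

theorem injOn_socleClass (n e : ℕ) :
    Set.InjOn socleClass (indecIsoclassesOfLength k Γ n e) := by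
  rintro _ ⟨M, -, hM, hnM, -, rfl⟩ _ ⟨N, -, hN, hnN, -, rfl⟩ h
  obtain ⟨i⟩ := Quotient.exact h
  obtain ⟨g⟩ := hΓ.nonempty_linearEquiv_of_moduleSocle hM hnM hN hnN i.toLinearEquiv
  exact Quotient.sound ⟨g.toModuleIso⟩

theorem image_socleClass_subset (hΓ' : ¬ IsSimpleModule Γ Γ) (n e : ℕ) {m : ℕ} (hm : m ≠ 0) :
    socleClass '' indecIsoclassesOfLength k Γ n e ⊆
      socleClass '' indecIsoclassesOfLength k Γ m e := by
  rintro _ ⟨_, ⟨M, hfin, hM, hn, he, rfl⟩, rfl⟩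
  have := hΓ.isSimpleModule_moduleSocle hM hn
  obtain ⟨N, _, _, hN, hmN, ⟨f⟩⟩ := hΓ.exists_isIndecomposableModule hΓ' (moduleSocle Γ M) hm
  have hfinN : Module.Finite k (RestrictScalars k Γ N) :=
    hΓ.finite_of_finite_moduleSocle hN hmN <|
      finite_restrictScalars_of_injective ((moduleSocle Γ M).subtype ∘ₗ f.toLinearMap)
        ((Submodule.injective_subtype _).comp f.injective) hfin
  exact ⟨_, ⟨.of Γ N, hfinN, hN, hmN, (endolength_congr f).trans he, rfl⟩,
    Quotient.sound ⟨f.toModuleIso⟩⟩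

theorem infinite_indecIsoclasses_mul (hΓ' : ¬ IsSimpleModule Γ Γ) {n e : ℕ}
    (hinf : (indecIsoclassesOfLength k Γ n e).Infinite) {m : ℕ} (hm : m ≠ 0) :
    (indecIsoclasses k Γ (m * e)).Infinite := by
  have himage : (socleClass '' indecIsoclassesOfLength k Γ m e).Infinite :=
    (hinf.image (hΓ.injOn_socleClass n e)).mono (hΓ.image_socleClass_subset hΓ' n e hm)
  exact himage.of_image.mono (hΓ.indecIsoclassesOfLength_subset m e)

theorem satisfiesEBTII (hd : ¬ IsEDiscrete k Γ) : SatisfiesEBTII k Γ := by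
  obtain ⟨d, hd⟩ : ∃ d, (indecIsoclasses k Γ d).Infinite := not_forall.1 hd
  have hΓ' : ¬ IsSimpleModule Γ Γ := fun _ => hd (subsingleton_indecIsoclasses d).finite
  have hd0 : d ≠ 0 := by
    rintro rfl
    exact hd.nonempty.ne_empty indecIsoclasses_zero
  obtain ⟨⟨n, e⟩, hne, hinf⟩ : ∃ x ∈ d.divisorsAntidiagonal,
      (indecIsoclassesOfLength k Γ x.1 x.2).Infinite := by
    by_contra! hfin
    exact hd ((Set.Finite.biUnion (Finset.finite_toSet _) hfin).subset
      (hΓ.indecIsoclasses_subset hd0))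
  have he : 0 < e := Nat.pos_of_ne_zero fun he0 => hd0 <| by
    simpa [he0] using (Nat.mem_divisorsAntidiagonal.1 hne).1.symm
  exact ⟨fun i => (i + 1) * e, fun i j hij => Nat.mul_lt_mul_of_pos_right (by lia) he,
    fun i => hΓ.infinite_indecIsoclasses_mul hΓ' hinf i.succ_ne_zero⟩

end IsBoundedPID

end Isoclasses

theorem corollaryC_general {k : Type v} [Field k] {Γ : Type u} [Ring Γ] [Algebra k Γ]
    (hΓ : IsBoundedPID Γ) :
    (∀ (M : Type*) [AddCommGroup M] [Module Γ M] (n : ℕ),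
      IsIndecomposableModule Γ M → Module.length Γ M = (n : ℕ∞) →
        IsSimpleModule Γ (moduleSocle Γ M) ∧
        endolength Γ M = (n : ℕ∞) * endolength Γ (moduleSocle Γ M)) ∧
    (∀ (M N : Type*) [AddCommGroup M] [Module Γ M] [AddCommGroup N] [Module Γ N] (n : ℕ),
      IsIndecomposableModule Γ M → Module.length Γ M = (n : ℕ∞) →
      IsIndecomposableModule Γ N → Module.length Γ N = (n : ℕ∞) →
      Nonempty (moduleSocle Γ M ≃ₗ[Γ] moduleSocle Γ N) → Nonempty (M ≃ₗ[Γ] N)) ∧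
    ((∃ a : Γ, a ≠ 0 ∧ ¬ IsUnit a) →
      ∀ (S : Type*) [AddCommGroup S] [Module Γ S], IsSimpleModule Γ S → ∀ n : ℕ, 1 ≤ n →
        ∃ (M : Type u) (_ : AddCommGroup M) (_ : Module Γ M),
          IsIndecomposableModule Γ M ∧ Module.length Γ M = (n : ℕ∞) ∧
          Nonempty (moduleSocle Γ M ≃ₗ[Γ] S)) ∧
    (¬ IsEDiscrete k Γ → SatisfiesEBTII k Γ) := by
  refine ⟨fun M _ _ n hM hn => ⟨hΓ.isSimpleModule_moduleSocle hM hn, hΓ.endolength_eq hM hn⟩,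
    fun M N _ _ _ _ n hM hnM hN hnN ⟨e⟩ =>
      hΓ.nonempty_linearEquiv_of_moduleSocle hM hnM hN hnN e,
    fun ⟨a, ha, hau⟩ S _ _ _ n hn => ?_, hΓ.satisfiesEBTII⟩
  have hΓ' : ¬ IsSimpleModule Γ Γ := fun _ => hau (isSimpleModule_self_iff_isUnit.1 ‹_› |>.2 a ha)
  exact hΓ.exists_isIndecomposableModule hΓ' S (Nat.one_le_iff_ne_zero.1 hn)

/-- Let `Γ` be a bounded principal ideal domain over a perfect field `k`.
(1) An indecomposable `Γ`-module `M` of finite length `n` has a simple socle `M₁`, and the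
endolength of `M` is `n` times that of `M₁`.
(2), (3) These modules `M` are determined up to isomorphism by `n` and `M₁`, and they exist for
all `n ≥ 1` and all simple `M₁` as soon as `Γ` is not a division ring.
(4) If `Γ` is not `e`-discrete, it satisfies EBTII. -/
theorem corollaryC {k : Type v} [Field k] [PerfectField k]
    {Γ : Type u} [Ring Γ] [Algebra k Γ] (hΓ : IsBoundedPID Γ) :
    (∀ (M : Type u) [AddCommGroup M] [Module Γ M] (n : ℕ),
      IsIndecomposableModule Γ M → Module.length Γ M = (n : ℕ∞) →
        IsSimpleModule Γ (moduleSocle Γ M) ∧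
        endolength Γ M = (n : ℕ∞) * endolength Γ (moduleSocle Γ M)) ∧
    (∀ (M N : Type u) [AddCommGroup M] [Module Γ M] [AddCommGroup N] [Module Γ N] (n : ℕ),
      IsIndecomposableModule Γ M → Module.length Γ M = (n : ℕ∞) →
      IsIndecomposableModule Γ N → Module.length Γ N = (n : ℕ∞) →
      Nonempty (moduleSocle Γ M ≃ₗ[Γ] moduleSocle Γ N) → Nonempty (M ≃ₗ[Γ] N)) ∧
    ((∃ a : Γ, a ≠ 0 ∧ ¬ IsUnit a) →
      ∀ (S : Type u) [AddCommGroup S] [Module Γ S], IsSimpleModule Γ S → ∀ n : ℕ, 1 ≤ n →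
        ∃ (M : Type u) (_ : AddCommGroup M) (_ : Module Γ M),
          IsIndecomposableModule Γ M ∧ Module.length Γ M = (n : ℕ∞) ∧
          Nonempty (moduleSocle Γ M ≃ₗ[Γ] S)) ∧
    (¬ IsEDiscrete k Γ → SatisfiesEBTII k Γ) :=
  corollaryC_general hΓ
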